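/- Concurrent game structures. Fix a finite set $AP$ of atomic propositions containing $ok$. A concurrent game structure is a tuple $\mathcal G=(S,S_0,Ag,(Ac_i)_{i},(\sim_i)_{i},(P_i)_{i},\Delta,\lambda)$ with finite sets $S$ of states, $S_0\subseteq S$ of initial states, $Ag=\{1,\dots,n\}$ of agents and $Ac_i$ of local actions of agent $i$; equivalence relations $\sim_i$ on $S$; protocols $P_i:S\to 2^{Ac_i}$ with $P_i(s)=P_i(s')$ whenever $s\sim_i s'$; a transition function $\Delta:S\times\prod_{i\in Ag}Ac_i\to S$; and a labeling $\lambda:S\to 2^{AP}$. An IR-strategy (perfect information, perfect recall) of agent $i$ is a function $\theta_i:S^+\to Ac_i$ with $\theta_i(s_0\cdots s_m)\in P_i(s_m)$ for all $s_0\cdots s_m\in S^+$. An iR-strategy (imperfect information, perfect recall) is an IR-strategy such that $\theta_i(s_0\cdots s_m)=\theta_i(s_0'\cdots s_m')$ whenever $s_j\sim_i s_j'$ for all $0\le j\le m$. An Ir-strategy (respectively ir-strategy) is given by a function $g:S\to Ac_i$ with $g(s)\in P_i(s)$ for all $s$ (respectively, with in addition $g(s)=g(s')$ whenever $s\sim_i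 s'$), via $\theta_i(s_0\cdots s_m)=g(s_m)$. An ACGS is a pair $\mathcal M=(\mathcal G,\pi)$ where $\pi:Ag\to\{\mathrm{Ir},\mathrm{IR},\mathrm{ir},\mathrm{iR}\}$ assigns a strategy type to each agent and $\sim_i$ is the identity for every agent $i$ with $\pi(i)\in\{\mathrm{IR},\mathrm{Ir}\}$. For a state $s$, $\mathcal M,s\models\langle\!\langle A\rangle\!\rangle \mathbf G\,ok$ means that the agents $i\in A$ have $\pi(i)$-strategies such that, for all choices of $\pi(i)$-strategies by the agents $i\notin A$, every state of the resulting infinite play $\rho_0\rho_1\rho_2\cdots$ from $\rho_0=s$ is labeled with $ok$; here $\rho_{j+1}=\Delta(\rho_j,\vec a_j)$, where $\vec a_j(i)$ is the action that agent $i$'s strategy assigns to $\rho_0\cdots\rho_j$. Theorem. For every $n\ge 3$ the following problem is undecidable: given (the explicit finite description of) an ACGS $\mathcal M=(\mathcal G,\pi)$ with agents $Ag=\{1,\dots,n\}$, $\pi(1)=\pi(2)=\mathrm{iR}$ and $\pi(i)=\mathrm{IR}$ for all $i\in Ag\setminus\{1,2\}$, decide whether $\mathcal M,s\models\langle\!\langle\{1,2\}\rangle\!\rangle\mathbf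 G\,ok$ for every initial state $s\in S_0$. That is, no computable function answers this question correctly on all such $\mathcal M$. -/

import Mathlib

/-- The four strategy types: `I`/`i` is perfect/imperfect information, `R`/`r` is
perfect/imperfect recall. -/
inductive StrategyType where
  | Ir | IR | ir | iR

/-- A concurrent game structure with agents `Fin n` (agent `j + 1` is the index `j`), atomic
propositions `AP`, states `S` and local actions `Ac i` of agent `i`. -/
structure CGS (n : ℕ) (AP S : Type) (Ac : Fin n → Type) where
  /-- the initial states -/
  init : Set S
  /-- the epistemic accessibility relations -/
  indist : Fin n → S → S → Prop
  indist_equivalence : ∀ i, Equivalence (indist i)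
  /-- the protocol functions: the local actions available to an agent in a state -/
  protocol : (i : Fin n) → S → Set (Ac i)
  protocol_eq : ∀ i s t, indist i s t → protocol i s = protocol i t
  /-- the transition function, on states and joint actions -/
  trans : S → ((i : Fin n) → Ac i) → S
  /-- the labeling function -/
  label : S → Set AP

/-- An agents' abilities augmented concurrent game structure: every agent has a strategy type,
and agents with perfect information distinguish any two distinct states. -/
structure ACGS (n : ℕ) (AP S : Type) (Ac : Fin n → Type) extends CGS n AP S Ac where
  /-- the strategy type of each agent -/
  type : Fin n → StrategyType
  perfect_info : ∀ i, type i = .IR ∨ type i = .Ir → ∀ s t, indist i s t → s = t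

/-- Nonempty finite words over `S`; `⟨j, h⟩` is the word `h 0 ⋯ h j`. -/
abbrev History (S : Type) := (j : ℕ) × (Fin (j + 1) → S)

/-- The last state of a history. -/
def History.last {S : Type} (h : History S) : S := h.2 (Fin.last h.1)

/-- The prefix `ρ₀ ⋯ ρⱼ` of an infinite word. -/
def historyOf {S : Type} (ρ : ℕ → S) (j : ℕ) : History S := ⟨j, fun l => ρ l⟩

namespace CGS

variable {n : ℕ} {AP S : Type} {Ac : Fin n → Type}

/-- Two histories of the same length are indistinguishable for agent `i` if they are so at every
position. -/
inductive HistIndist (G : CGS n AP S Ac) (i : Fin n) : History S → History S → Prop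
  | mk (j : ℕ) (h h' : Fin (j + 1) → S) (H : ∀ l, G.indist i (h l) (h' l)) :
      HistIndist G i ⟨j, h⟩ ⟨j, h'⟩

/-- `θ` is a strategy of agent `i` of the given type. A memoryless strategy `g : S → Ac i` is
identified with the function `h ↦ g (last h)` on histories. -/
def IsStrategy (G : CGS n AP S Ac) (i : Fin n) :
    StrategyType → (History S → Ac i) → Prop
  | .Ir, θ => ∃ g : S → Ac i, (∀ s, g s ∈ G.protocol i s) ∧ ∀ h, θ h = g h.last
  | .IR, θ => ∀ h, θ h ∈ G.protocol i h.last
  | .ir, θ => ∃ g : S → Ac i, (∀ s, g s ∈ G.protocol i s) ∧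
      (∀ s t, G.indist i s t → g s = g t) ∧ ∀ h, θ h = g h.last
  | .iR, θ => (∀ h, θ h ∈ G.protocol i h.last) ∧
      ∀ h h', G.HistIndist i h h' → θ h = θ h'

end CGS

namespace ACGS

variable {n : ℕ} {AP S : Type} {Ac : Fin n → Type}

/-- A collective strategy of the set `A` of agents: each agent of `A` gets a strategy of its own
type. -/
structure CollectiveStrategy (M : ACGS n AP S Ac) (A : Set (Fin n)) where
  strat : (i : Fin n) → i ∈ A → History S → Ac i
  isStrategy : ∀ i hi, M.IsStrategy i (M.type i) (strat i hi)

/-- `ρ` is the play from `s` that is determined by a collective strategy of `A` and one of the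
complement of `A`. -/
def IsPlay (M : ACGS n AP S Ac) {A : Set (Fin n)} (s : S) (ξ : M.CollectiveStrategy A)
    (ξ' : M.CollectiveStrategy Aᶜ) (ρ : ℕ → S) : Prop :=
  ρ 0 = s ∧ ∀ j, ∃ a : (i : Fin n) → Ac i,
    (∀ i hi, a i = ξ.strat i hi (historyOf ρ j)) ∧
    (∀ i hi, a i = ξ'.strat i hi (historyOf ρ j)) ∧
    ρ (j + 1) = M.trans (ρ j) a

/-- The outcome: all plays from `s` in which `A` follows `ξ` and the other agents follow
strategies of their own types. -/
def outcomes (M : ACGS n AP S Ac) {A : Set (Fin n)} (s : S) (ξ : M.CollectiveStrategy A) :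
    Set (ℕ → S) :=
  {ρ | ∃ ξ' : M.CollectiveStrategy Aᶜ, M.IsPlay s ξ ξ' ρ}

end ACGS

mutual
/-- State formulae of ATL*. -/
inductive StateFormula (Ag AP : Type) : Type where
  | atom (q : AP)
  | neg (φ : StateFormula Ag AP)
  | and (φ ψ : StateFormula Ag AP)
  | coalition (A : Set Ag) (φ : PathFormula Ag AP)
/-- Path formulae of ATL*. -/
inductive PathFormula (Ag AP : Type) : Type where
  | state (φ : StateFormula Ag AP)
  | neg (φ : PathFormula Ag AP)
  | and (φ ψ : PathFormula Ag AP)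
  | next (φ : PathFormula Ag AP)
  | untl (φ ψ : PathFormula Ag AP)
end

/-- `F φ := true U φ`, with `true` written as `¬ (φ ∧ ¬ φ)`. -/
def PathFormula.eventually {Ag AP : Type} (φ : PathFormula Ag AP) : PathFormula Ag AP :=
  .untl (.neg (.and φ (.neg φ))) φ

/-- `G φ := ¬ F ¬ φ`. -/
def PathFormula.globally {Ag AP : Type} (φ : PathFormula Ag AP) : PathFormula Ag AP :=
  .neg (PathFormula.eventually (.neg φ))

mutual
/-- `M, s ⊨ φ` for state formulae. -/
def ACGS.SatState {n : ℕ} {AP S : Type} {Ac : Fin n → Type} (M : ACGS n AP S Ac) :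
    StateFormula (Fin n) AP → S → Prop
  | .atom q, s => q ∈ M.label s
  | .neg φ, s => ¬ M.SatState φ s
  | .and φ ψ, s => M.SatState φ s ∧ M.SatState ψ s
  | .coalition A φ, s =>
      ∃ ξ : M.CollectiveStrategy A, ∀ ρ ∈ M.outcomes s ξ, M.SatPath φ ρ
/-- `M, ρ ⊨ φ` for path formulae. -/
def ACGS.SatPath {n : ℕ} {AP S : Type} {Ac : Fin n → Type} (M : ACGS n AP S Ac) :
    PathFormula (Fin n) AP → (ℕ → S) → Prop
  | .state φ, ρ => M.SatState φ (ρ 0)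
  | .neg φ, ρ => ¬ M.SatPath φ ρ
  | .and φ ψ, ρ => M.SatPath φ ρ ∧ M.SatPath ψ ρ
  | .next φ, ρ => M.SatPath φ (fun l => ρ (1 + l))
  | .untl φ ψ, ρ => ∃ k, M.SatPath ψ (fun l => ρ (k + l)) ∧
      ∀ j < k, M.SatPath φ (fun l => ρ (j + l))
end

/-- A finite ACGS with `n` agents and `k` atomic propositions, as an instance of a decision
problem: states and local actions are numbered. -/
structure FiniteACGS (n k : ℕ) where
  numStates : ℕ
  numActions : Fin n → ℕ
  model : ACGS n (Fin k) (Fin numStates) (fun i => Fin (numActions i))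

/-- The model satisfies `φ` in every initial state. -/
def FiniteACGS.Satisfies {n k : ℕ} (M : FiniteACGS n k) (φ : StateFormula (Fin n) (Fin k)) :
    Prop :=
  ∀ s ∈ M.model.init, M.model.SatState φ s

/-- Written-out descriptions of finite ACGSs: number of states, numbers of actions, and the tables
of initial states, indistinguishability, protocols, transitions, labels and types. -/
abbrev ACGSCode : Type :=
  ℕ × List ℕ × List Bool × List (List (List Bool)) × List (List (List Bool)) ×
    List (List ℕ) × List (List Bool) × List ℕ

/-- The numbering of the strategy types in descriptions. -/
def StrategyType.code : StrategyType → ℕ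
  | .Ir => 0
  | .IR => 1
  | .ir => 2
  | .iR => 3

open Classical in
/-- The description of a finite ACGS. Tables are indexed by agents, states, actions and
propositions in increasing order; joint actions are numbered by `finPiFinEquiv` (mixed radix). -/
noncomputable def FiniteACGS.code {n k : ℕ} (M : FiniteACGS n k) : ACGSCode :=
  (M.numStates,
    List.ofFn (fun i => M.numActions i),
    List.ofFn (fun s => decide (s ∈ M.model.init)),
    List.ofFn (fun i => List.ofFn fun s => List.ofFn fun t => decide (M.model.indist i s t)),
    List.ofFn (fun i => List.ofFn fun s => List.ofFn fun a => decide (a ∈ M.model.protocol i s)),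
    List.ofFn (fun s => List.ofFn fun a : Fin (∏ i, M.numActions i) =>
      (M.model.trans s (finPiFinEquiv.symm a) : ℕ)),
    List.ofFn (fun s => List.ofFn fun q => decide (q ∈ M.model.label s)),
    List.ofFn (fun i => (M.model.type i).code))

/-- The description determines the structure. -/
theorem FiniteACGS.code_injective {n k : ℕ} :
    Function.Injective (FiniteACGS.code : FiniteACGS n k → ACGSCode) := by
  rintro ⟨m, a, M⟩ ⟨m', a', M'⟩ h
  simp only [FiniteACGS.code, Prod.mk.injEq] at h
  obtain ⟨rfl, ha, h⟩ := h
  obtain rfl : a = a' := List.ofFn_injective ha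
  obtain ⟨h1, h2, h3, h4, h5, h6⟩ := h
  obtain ⟨⟨i, r, hr, p, hp, t, l⟩, ty, hI⟩ := M
  obtain ⟨⟨i', r', hr', p', hp', t', l'⟩, ty', hI'⟩ := M'
  have e1 : i = i' := by
    ext s
    simpa using congrFun (List.ofFn_injective h1) s
  have e2 : r = r' := by
    ext j s u
    simpa using congrFun (List.ofFn_injective
      (congrFun (List.ofFn_injective (congrFun (List.ofFn_injective h2) j)) s)) u
  have e3 : p = p' := by
    ext j s u
    simpa using congrFun (List.ofFn_injective
      (congrFun (List.ofFn_injective (congrFun (List.ofFn_injective h3) j)) s)) u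
  have e4 : t = t' := by
    ext s u
    simpa using congrFun (List.ofFn_injective (congrFun (List.ofFn_injective h4) s))
      (finPiFinEquiv u)
  have e5 : l = l' := by
    ext s u
    simpa using congrFun (List.ofFn_injective (congrFun (List.ofFn_injective h5) s)) u
  have e6 : ty = ty' := by
    ext j
    have := congrFun (List.ofFn_injective h6) j
    dsimp only at this
    revert this
    cases ty j <;> cases ty' j <;> simp [StrategyType.code]
  subst e1 e2 e3 e4 e5 e6
  rfl

/-- The model-checking problem for the formula `φ` on the class `C` of instances is decidable: some
computable function, given the description of any member of `C`, tells whether it satisfies `φ`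
(its values elsewhere are irrelevant). -/
def ModelCheckingDecidable {n k : ℕ} (C : Set (FiniteACGS n k))
    (φ : StateFormula (Fin n) (Fin k)) : Prop :=
  ∃ f : ACGSCode → Bool, Computable f ∧ ∀ M ∈ C, (f M.code = true ↔ M.Satisfies φ)

/-- A finite-memory device that reads an infinite word with lookahead one and predicts, letter by
letter, another infinite word, or rejects. -/
structure RowTransducer (A D : Type) where
  /-- the memory after the first letter -/
  start : A → D
  /-- the memory after a further letter -/
  next : D → A → D
  /-- the letter predicted from the memory and the lookahead -/
  out : D → A → Option A

namespace RowTransducer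

variable {A D B E : Type}

/-- The memory after reading `u 0 ⋯ u j`. -/
def mem (T : RowTransducer A D) (u : ℕ → A) : ℕ → D
  | 0 => T.start (u 0)
  | j + 1 => T.next (T.mem u j) (u (j + 1))

/-- The word predicted from `u` is `v`. -/
def Step (T : RowTransducer A D) (u v : ℕ → A) : Prop :=
  ∀ j, T.out (T.mem u j) (u (j + 1)) = some (v j)

/-- The transducer can be iterated forever from `w`. -/
def Runs (T : RowTransducer A D) (w : ℕ → A) : Prop :=
  ∃ r : ℕ → ℕ → A, r 0 = w ∧ ∀ p, T.Step (r p) (r (p + 1))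

/-- Renaming of letters and memory states. -/
def congr (T : RowTransducer A D) (a : A ≃ B) (d : D ≃ E) : RowTransducer B E where
  start x := d (T.start (a.symm x))
  next m x := d (T.next (d.symm m) (a.symm x))
  out m x := (T.out (d.symm m) (a.symm x)).map a

theorem mem_congr (T : RowTransducer A D) (a : A ≃ B) (d : D ≃ E) (u : ℕ → A) (j : ℕ) :
    (T.congr a d).mem (a ∘ u) j = d (T.mem u j) := by
  induction j with
  | zero => simp [mem, congr]
  | succ j ih => rw [mem, ih]; simp [mem, congr]

theorem step_congr (T : RowTransducer A D) (a : A ≃ B) (d : D ≃ E) (u v : ℕ → A) :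
    (T.congr a d).Step (a ∘ u) (a ∘ v) ↔ T.Step u v := by
  refine forall_congr' fun j => ?_
  rw [mem_congr]
  simp [congr]

theorem runs_congr (T : RowTransducer A D) (a : A ≃ B) (d : D ≃ E) (w : ℕ → A) :
    (T.congr a d).Runs (a ∘ w) ↔ T.Runs w := by
  constructor
  · rintro ⟨r, h0, hr⟩
    refine ⟨fun p => a.symm ∘ r p, by ext j; simp [h0], fun p => ?_⟩
    rw [← step_congr T a d]
    simpa [← Function.comp_assoc] using hr p
  · rintro ⟨r, h0, hr⟩
    exact ⟨fun p => a ∘ r p, by simp [h0], fun p => (step_congr T a d _ _).2 (hr p)⟩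

end RowTransducer

-- Stack machines and the transducers that compute their steps.

/-- What a stack machine does to a stack in one step. -/
inductive StackOp (Γ : Type) where
  | keep
  | push (x : Γ)
  | pop

/-- The effect of an operation on a stack. -/
def StackOp.apply {Γ : Type} : StackOp Γ → List Γ → List Γ
  | .keep, l => l
  | .push x, l => x :: l
  | .pop, l => l.tail

/-- The letter put on the stack, if any. -/
def StackOp.pushed {Γ : Type} : StackOp Γ → Option Γ
  | .push x => some x
  | _ => none

/-- The letter at some depth after an operation, from the letters one place higher, at the same
place and one place lower before it. -/
def StackOp.select {Γ : Type} : StackOp Γ → Option Γ → Option Γ → Option Γ → Option Γ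
  | .keep, _, y, _ => y
  | .push _, x, _, _ => x
  | .pop, _, _, z => z

/-- A deterministic machine with stacks `K` over the alphabet `Γ` and control states `Q`; the next
control state depends on the tops of the stacks, and the machine halts if there is none. -/
structure StackMachine (K Γ Q : Type) where
  op : Q → K → StackOp Γ
  next : Q → (K → Option Γ) → Option Q

namespace StackMachine

open StateTransition

variable {K Γ Q : Type}

/-- One step on configurations. -/
def step (P : StackMachine K Γ Q) (c : Q × (K → List Γ)) : Option (Q × (K → List Γ)) :=
  (P.next c.1 fun k => (c.2 k)[0]?).map fun q => (q, fun k => (P.op c.1 k).apply (c.2 k))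

/-- Letters of configurations written as infinite words. -/
abbrev Letter (K Γ Q : Type) := Q ⊕ (K → Option Γ)

/-- Memory of the transducer that computes successor configurations. -/
abbrev Memory (K Γ Q : Type) := Option (Q × Option ((K → Option Γ) × (K → Option Γ)))

/-- A configuration as an infinite word: the control state, then the stack contents from the tops
downwards. -/
def row (c : Q × (K → List Γ)) : ℕ → Letter K Γ Q
  | 0 => .inl c.1
  | j + 1 => .inr fun k => (c.2 k)[j]?

/-- The transducer that computes successor configurations. -/
def transducer (P : StackMachine K Γ Q) : RowTransducer (Letter K Γ Q) (Memory K Γ Q) where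
  start
    | .inl q => some (q, none)
    | .inr _ => none
  next
    | some (q, none), .inr t => some (q, some (fun k => (P.op q k).pushed, t))
    | some (q, some (_, y)), .inr t => some (q, some (y, t))
    | _, _ => none
  out
    | some (q, none), .inr t => (P.next q t).map .inl
    | some (q, some (x, y)), .inr t => some (.inr fun k => (P.op q k).select (x k) (y k) (t k))
    | _, _ => none

/-- The memory keeps the letters at depths `j - 1` and `j`, and the lookahead supplies depth `j +
1`; push, keep and pop need exactly these three. Above the top, the pushed letter stands in for the
missing one. -/
theorem mem_row_succ (P : StackMachine K Γ Q) (c : Q × (K → List Γ)) (j : ℕ) :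
    P.transducer.mem (row c) (j + 1) =
      some (c.1, some (fun k => if j = 0 then (P.op c.1 k).pushed else (c.2 k)[j - 1]?,
        fun k => (c.2 k)[j]?)) := by
  induction j with
  | zero => simp [RowTransducer.mem, row, transducer]
  | succ j ih => rw [RowTransducer.mem, ih]; simp [row, transducer]

theorem select_eq (o : StackOp Γ) (l : List Γ) (j : ℕ) :
    o.select (if j = 0 then o.pushed else l[j - 1]?) l[j]? l[j + 1]? = (o.apply l)[j]? := by
  cases o <;> cases j <;> simp [StackOp.select, StackOp.pushed, StackOp.apply]

theorem out_row_succ (P : StackMachine K Γ Q) (c : Q × (K → List Γ)) (j : ℕ) :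
    P.transducer.out (P.transducer.mem (row c) (j + 1)) (row c (j + 1 + 1)) =
      some (.inr fun k => ((P.op c.1 k).apply (c.2 k))[j]?) := by
  rw [mem_row_succ]
  simp only [transducer, row, select_eq]

theorem out_row_zero (P : StackMachine K Γ Q) (c : Q × (K → List Γ)) :
    P.transducer.out (P.transducer.mem (row c) 0) (row c (0 + 1)) =
      (P.next c.1 fun k => (c.2 k)[0]?).map .inl := rfl

/-- Halting shows at letter `0`, the only place where the prediction on a row can fail. -/
theorem step_row_iff (P : StackMachine K Γ Q) (c : Q × (K → List Γ)) (v : ℕ → Letter K Γ Q) :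
    P.transducer.Step (row c) v ↔ ∃ c', P.step c = some c' ∧ v = row c' := by
  constructor
  · intro h
    have h0 := h 0
    rw [out_row_zero, Option.map_eq_some_iff] at h0
    obtain ⟨q, hq, hv⟩ := h0
    refine ⟨_, by rw [step, hq]; rfl, funext fun j => ?_⟩
    cases j with
    | zero => exact hv.symm
    | succ j =>
      have := h (j + 1)
      rw [out_row_succ] at this
      exact (Option.some.inj this).symm
  · rintro ⟨c', hc, rfl⟩ j
    rw [step, Option.map_eq_some_iff] at hc
    obtain ⟨q, hq, rfl⟩ := hc
    cases j with
    | zero => rw [out_row_zero, hq]; rfl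
    | succ j => rw [out_row_succ]; rfl

/-- The transducer can be iterated forever iff the machine does not halt. -/
theorem runs_row_iff (P : StackMachine K Γ Q) (c : Q × (K → List Γ)) :
    P.transducer.Runs (row c) ↔ ¬ (eval P.step c).Dom := by
  constructor
  · rintro ⟨r, h0, hr⟩ hdom
    obtain ⟨b, hb⟩ := Part.dom_iff_mem.1 hdom
    obtain ⟨hreach, hnone⟩ := mem_eval.1 hb
    have : ∃ p, r p = row b := by
      clear hnone hb
      induction hreach with
      | refl => exact ⟨0, h0⟩
      | tail _ hstep ih =>
        obtain ⟨p, hp⟩ := ih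
        have h := hr p
        rw [hp, step_row_iff] at h
        obtain ⟨c', hc', hv⟩ := h
        exact ⟨p + 1, by rw [hv, Option.mem_unique hstep hc']⟩
    obtain ⟨p, hp⟩ := this
    have h := hr p
    rw [hp, step_row_iff, hnone] at h
    obtain ⟨c', hc', _⟩ := h
    cases hc'
  · intro hdom
    have hsome : ∀ b, Reaches P.step c b → ∃ b', P.step b = some b' := by
      intro b hb
      by_contra hcon
      exact hdom (Part.dom_iff_mem.2 ⟨b, mem_eval.2 ⟨hb,
        Option.eq_none_iff_forall_ne_some.2 fun x hx => hcon ⟨x, hx⟩⟩⟩)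
    choose! f hf using hsome
    have hreach : ∀ p, Reaches P.step c (f^[p] c) := by
      intro p
      induction p with
      | zero => exact .refl
      | succ p ih => rw [Function.iterate_succ_apply']; exact ih.tail (hf _ ih)
    refine ⟨fun p => row (f^[p] c), rfl, fun p => (step_row_iff _ _ _).2 ⟨_, hf _ (hreach p), ?_⟩⟩
    exact congrArg row (Function.iterate_succ_apply' f p c)

/-- The restriction of a machine to a set of control states that it does not leave. -/
def restrict (P : StackMachine K Γ Q) (F : Set Q)
    (hF : ∀ q ∈ F, ∀ t, ∀ q' ∈ P.next q t, q' ∈ F) : StackMachine K Γ F where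
  op q := P.op q
  next q t := (P.next q t).attach.map fun x => ⟨x.1, hF q q.2 t x.1 x.2⟩

/-- The inclusion is a step-for-step simulation. Restricting matters because the type of program
statements is infinite, while the transducer needs a finite alphabet and memory. -/
theorem eval_restrict_dom (P : StackMachine K Γ Q) (F : Set Q)
    (hF : ∀ q ∈ F, ∀ t, ∀ q' ∈ P.next q t, q' ∈ F) (q : F) (S : K → List Γ) :
    (eval (P.restrict F hF).step (q, S)).Dom ↔ (eval P.step (q.1, S)).Dom := by
  have key : ∀ c : F × (K → List Γ), P.step (c.1.1, c.2) =
      ((P.restrict F hF).step c).map fun c => (c.1.1, c.2) := by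
    rintro ⟨q, S⟩
    simp only [step, restrict, Option.map_map]
    conv_lhs => rw [← Option.attach_map_subtype_val (P.next q fun k => (S k)[0]?), Option.map_map]
    rfl
  refine (tr_eval_dom (f₁ := (P.restrict F hF).step) (f₂ := P.step)
    (tr := fun c c' => c' = (c.1.1, c.2)) ?_ rfl).symm
  rintro c _ rfl
  rcases h : (P.restrict F hF).step c with _ | c'
  · simpa [h] using key c
  · exact ⟨_, rfl, .single (by rw [Option.mem_def, key, h]; rfl)⟩

end StackMachine

-- `TM2` programs as stack machines.

namespace StackMachine

open StateTransition Turing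

variable {K Γ Λ σ : Type} [DecidableEq K]

/-- A `TM2` program as a stack machine that executes one statement per step. -/
def ofTM2 (M : Λ → TM2.Stmt (fun _ : K => Γ) Λ σ) :
    StackMachine K Γ (Option (TM2.Stmt (fun _ : K => Γ) Λ σ) × σ) where
  op
    | (some (.push k f _), v) => Function.update (fun _ => .keep) k (.push (f v))
    | (some (.pop k _ _), _) => Function.update (fun _ => .keep) k .pop
    | _ => fun _ => .keep
  next
    | (some (.push _ _ q), v), _ => some (some q, v)
    | (some (.peek k f q), v), t => some (some q, f v (t k))
    | (some (.pop k f q), v), t => some (some q, f v (t k))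
    | (some (.load f q), v), _ => some (some q, f v)
    | (some (.branch f q q'), v), _ => some (some (bif f v then q else q'), v)
    | (some (.goto l), v), _ => some (some (M (l v)), v)
    | (some .halt, v), _ => some (none, v)
    | (none, _), _ => none

/-- A configuration of a `TM2` program as a configuration of the stack machine. -/
def ofCfg (M : Λ → TM2.Stmt (fun _ : K => Γ) Λ σ) (c : TM2.Cfg (fun _ : K => Γ) Λ σ) :
    (Option (TM2.Stmt (fun _ : K => Γ) Λ σ) × σ) × (K → List Γ) :=
  ((c.l.map M, c.var), c.stk)

theorem apply_update (S : K → List Γ) (k : K) (o : StackOp Γ) :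
    (fun k' => (Function.update (fun _ => StackOp.keep) k o k').apply (S k')) =
      Function.update S k (o.apply (S k)) := by
  ext1 k'
  rcases eq_or_ne k' k with rfl | h
  · simp
  · simp [h, StackOp.apply]

/-- One `TM2` step executes a statement up to its jump or halt; the stack machine spends one step on
each constructor along the way, hence at least one in all. -/
theorem reaches₁_stepAux (M : Λ → TM2.Stmt (fun _ : K => Γ) Λ σ)
    (q : TM2.Stmt (fun _ : K => Γ) Λ σ) (v : σ) (S : K → List Γ) :
    Reaches₁ (ofTM2 M).step ((some q, v), S) (ofCfg M (TM2.stepAux q v S)) := by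
  induction q generalizing v S with
  | push k f q ih =>
    refine .head ?_ (ih v _)
    simp only [step, ofTM2, apply_update]
    rfl
  | peek k f q ih =>
    refine .head ?_ (ih _ S)
    simp [step, ofTM2, StackOp.apply, List.head?_eq_getElem?]
  | pop k f q ih =>
    refine .head ?_ (ih _ _)
    simp only [step, ofTM2, apply_update, List.head?_eq_getElem?]
    rfl
  | load f q ih =>
    refine .head ?_ (ih _ S)
    simp [step, ofTM2, StackOp.apply]
  | branch f q q' ih ih' =>
    rw [TM2.stepAux]
    cases h : f v
    · refine .head ?_ (ih' _ S)
      simp [step, ofTM2, StackOp.apply, h]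
    · refine .head ?_ (ih _ S)
      simp [step, ofTM2, StackOp.apply, h]
  | goto l => exact .single (by simp [step, ofTM2, StackOp.apply, ofCfg])
  | halt => exact .single (by simp [step, ofTM2, StackOp.apply, ofCfg])

theorem eval_ofTM2_dom (M : Λ → TM2.Stmt (fun _ : K => Γ) Λ σ)
    (c : TM2.Cfg (fun _ : K => Γ) Λ σ) :
    (eval (ofTM2 M).step (ofCfg M c)).Dom ↔ (eval (TM2.step M) c).Dom := by
  refine tr_eval_dom (tr := fun c c' => ofCfg M c = c') ?_ rfl
  rintro ⟨l, v, S⟩ _ rfl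
  cases l with
  | none => simp [step, ofTM2, ofCfg]
  | some l => exact ⟨_, rfl, reaches₁_stepAux M (M l) v S⟩

theorem next_ofTM2_mem [Inhabited Λ] {M : Λ → TM2.Stmt (fun _ : K => Γ) Λ σ} {L : Finset Λ}
    (hL : TM2.Supports M L) (q) (hq : q.1 ∈ TM2.stmts M L) (t : K → Option Γ) (q')
    (h : q' ∈ (ofTM2 M).next q t) : q'.1 ∈ TM2.stmts M L := by
  classical
  have sub : ∀ {q₁ q₂}, some q₂ ∈ TM2.stmts M L → q₁ ∈ TM2.stmts₁ q₂ → some q₁ ∈ TM2.stmts M L :=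
    fun h₁ h₂ => TM2.stmts_trans h₂ h₁
  obtain ⟨q, v⟩ := q
  cases q with
  | none => simp [ofTM2] at h
  | some q =>
    cases q with
    | goto l =>
      simp only [ofTM2, Option.mem_def, Option.some.injEq] at h
      subst h
      simp only [TM2.stmts, Finset.some_mem_insertNone, Finset.mem_biUnion]
      exact ⟨l v, TM2.stmts_supportsStmt hL hq v, TM2.stmts₁_self⟩
    | halt =>
      simp only [ofTM2, Option.mem_def, Option.some.injEq] at h
      subst h
      exact Finset.none_mem_insertNone
    | branch f q₁ q₂ =>
      simp only [ofTM2, Option.mem_def, Option.some.injEq] at h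
      subst h
      refine sub hq ?_
      cases f v <;> simp [TM2.stmts₁, TM2.stmts₁_self]
    | _ =>
      simp only [ofTM2, Option.mem_def, Option.some.injEq] at h
      subst h
      exact sub hq (by simp [TM2.stmts₁, TM2.stmts₁_self])

end StackMachine

-- Computability of the binary input encoding.

namespace Turing.PartrecToTM2

theorem trNat_posNum (p : PosNum) : trNat (p : ℕ) = trPosNum p := by
  rw [trNat, ← Num.cast_pos, Num.of_to_nat]
  rfl

theorem trNat_eq (n : ℕ) (hn : n ≠ 0) :
    trNat n = (if n.bodd then Γ'.bit1 else Γ'.bit0) :: trNat n.div2 := by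
  obtain ⟨p, rfl⟩ : ∃ p : PosNum, (p : ℕ) = n := by
    have h := Num.to_of_nat n
    rcases hm : (n : Num) with _ | p
    · rw [hm] at h
      exact absurd h.symm hn
    · rw [hm] at h
      exact ⟨p, h⟩
  have two (m : ℕ) : m + m = 2 * m := (two_mul m).symm
  cases p with
  | one =>
    rw [trNat_posNum]
    simp [trPosNum]
  | bit0 p =>
    rw [trNat_posNum, PosNum.cast_bit0, two]
    simp [trPosNum, trNat_posNum, Nat.div2_val]
  | bit1 p =>
    have h (m : ℕ) : (2 * m + 1).div2 = m := by rw [Nat.div2_val]; omega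
    rw [trNat_posNum, PosNum.cast_bit1, two, h]
    simp [trPosNum, trNat_posNum]

/-- Renaming the digits of the binary representation is primitive recursive. -/
theorem primrec_map_trNat {α : Type} [Primcodable α] (f : Γ' → α) :
    Primrec fun n => (trNat n).map f := by
  have : Primrec₂ fun (_ : Unit) n => (trNat n).map f := by
    -- Here `l` lists the values at `0, …, n - 1`, so `l.length` is `n` itself; digits come least
    -- significant first.
    refine Primrec.nat_strong_rec _ (g := fun _ l => if l.length = 0 then some [] else
      (l[l.length.div2]?).map fun r => (if l.length.bodd then f .bit1 else f .bit0) :: r) ?_ ?_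
    · refine Primrec.ite (Primrec.eq.comp (Primrec.list_length.comp .snd) (.const 0)) (.const _) ?_
      refine Primrec.option_map (Primrec.list_getElem?.comp .snd
        (Primrec.nat_div2.comp (Primrec.list_length.comp .snd))) ?_
      refine Primrec.list_cons.comp (Primrec.ite ?_ (.const _) (.const _)) .snd
      exact Primrec.eq.comp (Primrec.nat_bodd.comp
        (Primrec.list_length.comp (Primrec.snd.comp .fst))) (.const true)
    · intro _ n
      rcases eq_or_ne n 0 with rfl | hn
      · simp
      · have : n.div2 < n := by rw [Nat.div2_val]; omega
        simp [hn, this, trNat_eq n hn]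
        split <;> rfl
  exact this.comp (.const ()) .id

end Turing.PartrecToTM2

-- A universal transducer.

open Turing.PartrecToTM2 in
/-- There is a finite transducer for which it is undecidable whether it can be iterated forever from
an eventually constant word. -/
theorem RowTransducer.exists_universal :
    ∃ (m d : ℕ) (T : RowTransducer (Fin m) (Fin d)) (w : Nat.Partrec.Code → List (Fin m))
      (pad : Fin m), 4 ≤ m ∧ Computable w ∧
        ∀ c, T.Runs (fun j => (w c).getD j pad) ↔ ¬ (c.eval 0).Dom := by
  classical
  have hpart : Partrec fun n : ℕ => (Denumerable.ofNat Nat.Partrec.Code n).eval 0 :=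
    Nat.Partrec.Code.eval_part.comp (Computable.ofNat _) (.const 0)
  obtain ⟨c₀, hc₀⟩ := Turing.ToPartrec.Code.exists_code (Nat.Partrec'.part_iff₁.2 hpart)
  -- `TM2.Supports` requires the default label to lie in the support, so the default has to be the
  -- start label.
  let _ : Inhabited Λ' := ⟨trNormal c₀ .halt⟩
  let L := codeSupp c₀ .halt
  have hL : Turing.TM2.Supports tr L := tr_supports c₀ .halt
  let F : Set (Option (Turing.TM2.Stmt (fun _ : K' => Γ') Λ' (Option Γ')) × Option Γ') :=
    {q | q.1 ∈ Turing.TM2.stmts tr L}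
  have hF : ∀ q ∈ F, ∀ t, ∀ q' ∈ (StackMachine.ofTM2 tr).next q t, q' ∈ F :=
    fun q hq t q' h => StackMachine.next_ofTM2_mem hL q hq t q' h
  have hfin : F.Finite := by
    refine ((Finset.finite_toSet (Turing.TM2.stmts tr L)).prod
      (Set.finite_univ (α := Option Γ'))).subset fun q hq => ⟨hq, trivial⟩
  have : Finite F := hfin
  let _ : Fintype K' := ⟨{.main, .rev, .aux, .stack}, fun k => by cases k <;> decide⟩
  let P := (StackMachine.ofTM2 tr).restrict F hF
  obtain ⟨m, ⟨eA⟩⟩ := Finite.exists_equiv_fin (StackMachine.Letter K' Γ' F)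
  obtain ⟨d, ⟨eD⟩⟩ := Finite.exists_equiv_fin (StackMachine.Memory K' Γ' F)
  have hq₀ : (some (tr (trNormal c₀ .halt)), none) ∈ F := by
    refine Finset.some_mem_insertNone.2 (Finset.mem_biUnion.2 ⟨_, hL.1, ?_⟩)
    exact Turing.TM2.stmts₁_self
  let pad := eA (.inr fun _ => none)
  let f : Γ' → Fin m := fun x => eA (.inr fun k => if k = .main then some x else none)
  refine ⟨m, d, P.transducer.congr eA eD,
    fun c => eA (.inl ⟨_, hq₀⟩) :: (trList [Encodable.encode c]).map f, pad, ?_, ?_, fun c => ?_⟩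
  -- The stack alphabet already has four letters. The opponent will need four actions, and all
  -- agents share the alphabet as their action set.
  · let g : Γ' → StackMachine.Letter K' Γ' F := fun x => .inr fun _ => some x
    have hg : Function.Injective (eA ∘ g) := eA.injective.comp fun x y h => by
      simpa using congrFun (Sum.inr.inj h) K'.main
    have := Fintype.card_le_of_injective _ hg
    rwa [Fintype.card_fin] at this
  · refine Computable.list_cons.comp (.const _) (Primrec.to_comp ?_)
    simp only [trList, List.map_append, List.map_cons, List.map_nil]
    exact Primrec.list_append.comp ((primrec_map_trNat f).comp .encode) (.const _)
  · have hrow : (fun j => (eA (.inl ⟨_, hq₀⟩) ::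
        (trList [Encodable.encode c]).map f).getD j pad) =
        eA ∘ StackMachine.row (Γ := Γ') ((⟨_, hq₀⟩ : F),
          K'.elim (trList [Encodable.encode c]) [] [] []) := by
      funext j
      cases j with
      | zero => rfl
      | succ j =>
        rw [List.getD_cons_succ, List.getD_eq_getElem?_getD, List.getElem?_map]
        simp only [StackMachine.row, Function.comp_apply]
        rcases h : (trList [Encodable.encode c])[j]? with _ | x
        all_goals
          refine congrArg eA (congrArg Sum.inr (funext fun k => ?_))
          cases k <;> simp [K'.elim, h, -trList]
    rw [hrow, RowTransducer.runs_congr, StackMachine.runs_row_iff,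
      StackMachine.eval_restrict_dom]
    have h := StackMachine.eval_ofTM2_dom tr (init c₀ [Encodable.encode c])
    have h' := hc₀ ⟨[Encodable.encode c], rfl⟩
    erw [tr_eval] at h
    refine not_congr (h.trans ?_)
    simp only [h']
    simp [List.Vector.head]

-- Safety objectives and existence of plays.

namespace ACGS

variable {n : ℕ} {AP S : Type} {Ac : Fin n → Type}

theorem satState_globally_iff (M : ACGS n AP S Ac) (A : Set (Fin n)) (q : AP) (s : S) :
    M.SatState (.coalition A (PathFormula.globally (.state (.atom q)))) s ↔
      ∃ ξ : M.CollectiveStrategy A, ∀ ρ ∈ M.outcomes s ξ, ∀ t, q ∈ M.label (ρ t) := by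
  simp [SatState, SatPath, PathFormula.globally, PathFormula.eventually]

/-- The infinite word in which every state is determined by the preceding ones. -/
def unroll (s : S) (f : History S → S) : ℕ → S
  | 0 => s
  | j + 1 => f ⟨j, fun l => unroll s f l.1⟩
decreasing_by exact l.2

theorem unroll_succ (s : S) (f : History S → S) (j : ℕ) :
    unroll s f (j + 1) = f (historyOf (unroll s f) j) := by
  rw [unroll]; rfl

open Classical in
theorem exists_isPlay (M : ACGS n AP S Ac) {A : Set (Fin n)} (s : S)
    (ξ : M.CollectiveStrategy A) (ξ' : M.CollectiveStrategy Aᶜ) : ∃ ρ, M.IsPlay s ξ ξ' ρ := by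
  let a (h : History S) (i : Fin n) : Ac i :=
    if hi : i ∈ A then ξ.strat i hi h else ξ'.strat i hi h
  refine ⟨unroll s fun h => M.trans h.last (a h), by rw [unroll], fun j =>
    ⟨a (historyOf _ j), fun i hi => dif_pos hi, fun i hi => dif_neg hi, ?_⟩⟩
  rw [unroll_succ]
  rfl

end ACGS

-- The game and its instances.

namespace RowGame

variable {m d : ℕ} (T : RowTransducer (Fin m) (Fin d)) (w : List (Fin m)) (pad : Fin m)

/-- The transition function of the game, on numbered states:
* `0` is the losing sink, `1` the initial state and `2` the waiting state;
* in `3` the two players have to write the same word;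
* in `4` and `5 + e` the second player has to write the word predicted from that of the first
  player, who is one letter ahead, and `e` is the memory of the transducer;
* in `5 + d + j` the first player has to write the word `w`, continued by `pad`, and `j` is the
  position in `w`.
The players write the letters `a` and `b`, and the opponent chooses `c`. -/
def trans (s : ℕ) (a b : Fin m) (c : ℕ) : ℕ :=
  if s = 0 then 0
  else if s = 1 then if c = 0 then 2 else if c = 1 then 3 else if c = 2 then 4 else 5 + d
  else if s = 2 then if c = 1 then 3 else if c = 2 then 4 else 2
  else if s = 3 then if a = b then 3 else 0
  else if s = 4 then 5 + T.start a
  else if h : s - 5 < d then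
    if T.out ⟨s - 5, h⟩ a = some b then 5 + T.next ⟨s - 5, h⟩ a else 0
  else if w.getD (s - (5 + d)) pad = a then min (s + 1) (5 + d + w.length) else 0

/-- What agent number `i` sees of a state: the players only see whether they have to write. -/
def obs (i s : ℕ) : ℕ :=
  if i = 0 then if s = 1 ∨ s = 2 then 0 else 1
  else if i = 1 then if s = 1 ∨ s = 2 ∨ s = 4 then 0 else 1
  else s

variable (a b : Fin m) (c : ℕ)

theorem trans_one : trans T w pad 1 a b c =
    if c = 0 then 2 else if c = 1 then 3 else if c = 2 then 4 else 5 + d := by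
  simp [trans]

theorem trans_two : trans T w pad 2 a b c =
    if c = 1 then 3 else if c = 2 then 4 else 2 := by
  simp [trans]

theorem trans_three : trans T w pad 3 a b c = if a = b then 3 else 0 := by
  simp [trans]

theorem trans_four : trans T w pad 4 a b c = 5 + T.start a := by
  simp [trans]

theorem trans_compare (e : Fin d) : trans T w pad (5 + e) a b c =
    if T.out e a = some b then 5 + (T.next e a : ℕ) else 0 := by
  have h : ∀ x : ℕ, x < 5 → 5 + (e : ℕ) ≠ x := by omega
  simp [trans, h]

theorem trans_input (j : ℕ) : trans T w pad (5 + d + j) a b c =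
    if w.getD j pad = a then 5 + d + min (j + 1) w.length else 0 := by
  have h : ∀ x : ℕ, x < 5 → 5 + d + j ≠ x := by omega
  have h' : ¬ 5 + d + j - 5 < d := by omega
  have h'' : min (5 + d + j + 1) (5 + d + w.length) = 5 + d + min (j + 1) w.length := by omega
  simp [trans, h, h', h'']

theorem trans_lt (s : ℕ) : trans T w pad s a b c < 5 + d + (w.length + 1) := by
  unfold trans
  split_ifs <;> omega

/-- The game as a concurrent game structure: agents `0` and `1` write, agent `2` is the opponent,
and the other agents have no influence. -/
def model (n k : ℕ) (hn : 3 ≤ n) :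
    ACGS n (Fin k) (Fin (5 + d + (w.length + 1))) (fun _ => Fin m) where
  init := {s | (s : ℕ) = 1}
  indist i s t := obs i s = obs i t
  indist_equivalence _ := ⟨fun _ => rfl, fun h => h.symm, fun h h' => h.trans h'⟩
  protocol _ _ := Set.univ
  protocol_eq _ _ _ _ := rfl
  trans s a := ⟨trans T w pad s (a ⟨0, by omega⟩) (a ⟨1, by omega⟩) (a ⟨2, by omega⟩),
    trans_lt ..⟩
  label s := {_q | (s : ℕ) ≠ 0}
  type i := if (i : ℕ) = 0 ∨ (i : ℕ) = 1 then .iR else .IR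
  perfect_info i hi s t h := by
    by_cases h' : (i : ℕ) = 0 ∨ (i : ℕ) = 1
    · simp [h'] at hi
    · simp only [obs, not_or.1 h', if_false] at h
      exact Fin.ext h

/-- The game as an instance of the model-checking problem. -/
def instanceOf (n k : ℕ) (hn : 3 ≤ n) : FiniteACGS n k where
  numStates := 5 + d + (w.length + 1)
  numActions _ := m
  model := model T w pad n k hn

end RowGame

-- From an infinite run to a winning strategy.

namespace RowGame

variable {m d : ℕ} (T : RowTransducer (Fin m) (Fin d)) (w : List (Fin m)) (pad : Fin m)

/-- The two players. -/
def players (n : ℕ) : Set (Fin n) := {i | (i : ℕ) = 0 ∨ (i : ℕ) = 1}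

theorem zero_mem_players {n : ℕ} (hn : 3 ≤ n) : (⟨0, by omega⟩ : Fin n) ∈ players n := .inl rfl

theorem one_mem_players {n : ℕ} (hn : 3 ≤ n) : (⟨1, by omega⟩ : Fin n) ∈ players n := .inr rfl

section Strategy

variable {n k : ℕ} {hn : 3 ≤ n}

theorem play_step (ξ : (model T w pad n k hn).CollectiveStrategy (players n)) {s}
    {ρ : ℕ → Fin (5 + d + (w.length + 1))} (hρ : ρ ∈ (model T w pad n k hn).outcomes s ξ) (t : ℕ) :
    ∃ c, (ρ (t + 1) : ℕ) = trans T w pad (ρ t)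
      (ξ.strat ⟨0, by omega⟩ (zero_mem_players hn) (historyOf ρ t))
      (ξ.strat ⟨1, by omega⟩ (one_mem_players hn) (historyOf ρ t)) c := by
  obtain ⟨ξ', -, h⟩ := hρ
  obtain ⟨a, ha, -, h⟩ := h t
  refine ⟨a ⟨2, by omega⟩, ?_⟩
  rw [h, ← ha, ← ha]
  rfl

/-- How often agent `i` has seen the signal to write. -/
def writes {N : ℕ} (i : ℕ) (h : History (Fin N)) : ℕ := ∑ l, obs i (h.2 l)

/-- How often agent `i` has seen the signal to wait. -/
def waits {N : ℕ} (i : ℕ) (h : History (Fin N)) : ℕ := ∑ l, (1 - obs i (h.2 l))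

theorem writes_historyOf {N : ℕ} (i : ℕ) (ρ : ℕ → Fin N) (t : ℕ) :
    writes i (historyOf ρ t) = ∑ l : Fin (t + 1), obs i (ρ l) := rfl

theorem writes_succ {N : ℕ} (i : ℕ) (ρ : ℕ → Fin N) (t : ℕ) :
    writes i (historyOf ρ (t + 1)) = writes i (historyOf ρ t) + obs i (ρ (t + 1)) := by
  rw [writes_historyOf, writes_historyOf, Fin.sum_univ_castSucc]
  rfl

theorem waits_historyOf {N : ℕ} (i : ℕ) (ρ : ℕ → Fin N) (t : ℕ) :
    waits i (historyOf ρ t) = ∑ l : Fin (t + 1), (1 - obs i (ρ l)) := rfl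

theorem waits_succ {N : ℕ} (i : ℕ) (ρ : ℕ → Fin N) (t : ℕ) :
    waits i (historyOf ρ (t + 1)) = waits i (historyOf ρ t) + (1 - obs i (ρ (t + 1))) := by
  rw [waits_historyOf, waits_historyOf, Fin.sum_univ_castSucc]
  rfl

/-- The players write the words `r p`, where `p + 1` is the number of signals to wait. -/
def writeRows (r : ℕ → ℕ → Fin m) : (model T w pad n k hn).CollectiveStrategy (players n) where
  -- Both counts include the current state. Before the first signal to write, the truncated
  -- subtraction gives a letter that the game ignores.
  strat i _ h := r (waits i h - 1) (writes i h - 1)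
  isStrategy i hi := by
    have : (model T w pad n k hn).type i = .iR := if_pos hi
    rw [this]
    refine ⟨fun _ => trivial, ?_⟩
    rintro _ _ ⟨j, h, h', H⟩
    have H : ∀ l, obs i (h l) = obs i (h' l) := H
    simp [waits, writes, H]

/-- The positions that occur when the players write the words `r p`: the state, and for both
players the numbers of signals to wait and to write. -/
inductive Reachable (r : ℕ → ℕ → Fin m) : ℕ → ℕ → ℕ → ℕ → ℕ → Prop
  | start : Reachable r 1 1 0 1 0
  | wait (p : ℕ) : Reachable r 2 (p + 1) 0 (p + 1) 0
  | equal (p j : ℕ) : Reachable r 3 (p + 1) (j + 1) (p + 1) (j + 1)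
  | ahead (p : ℕ) : Reachable r 4 (p + 1) 1 (p + 2) 0
  | compare (p j : ℕ) (s : ℕ) (hs : s = 5 + T.mem (r p) j) :
      Reachable r s (p + 1) (j + 2) (p + 2) (j + 1)
  | input (j : ℕ) (s : ℕ) (hs : s = 5 + d + min j w.length) :
      Reachable r s 1 (j + 1) 1 (j + 1)

theorem Reachable.ne_zero {r : ℕ → ℕ → Fin m} {s x y x' y' : ℕ}
    (h : Reachable T w r s x y x' y') : s ≠ 0 := by
  cases h <;> omega

/-- The position counter saturates at `w.length`, where `getD` already returns `pad`; so finitely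
many states check the whole infinite word. -/
theorem getD_min (j : ℕ) : w.getD (min j w.length) pad = w.getD j pad := by
  rcases le_total j w.length with h | h
  · rw [min_eq_left h]
  · rw [min_eq_right h, List.getD_eq_default _ _ le_rfl, List.getD_eq_default _ _ h]

theorem obs_write (i s : ℕ) (hi : i < 2) (hs : 5 ≤ s) : obs i s = 1 := by
  unfold obs
  split_ifs <;> omega

/-- No test fails: in `equal` both players read the same row, in `compare` the second player's extra
wait puts it on row `p + 1`, where `hr` applies, and in `input` the row is `r 0`. -/
theorem Reachable.step {r : ℕ → ℕ → Fin m} (h0 : ∀ j, r 0 j = w.getD j pad)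
    (hr : ∀ p, T.Step (r p) (r (p + 1))) {s x y x' y' : ℕ} (h : Reachable T w r s x y x' y')
    (c s' : ℕ) (hs' : s' = trans T w pad s (r (x - 1) (y - 1)) (r (x' - 1) (y' - 1)) c) :
    Reachable T w r s' (x + (1 - obs 0 s')) (y + obs 0 s')
      (x' + (1 - obs 1 s')) (y' + obs 1 s') := by
  have o5 : ∀ e, obs 0 (5 + e) = 1 ∧ obs 1 (5 + e) = 1 := fun e =>
    ⟨obs_write _ _ (by omega) (by omega), obs_write _ _ (by omega) (by omega)⟩
  cases h with
  | start =>
    rw [trans_one] at hs'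
    split_ifs at hs' <;> subst hs'
    · exact .wait 1
    · exact .equal 0 0
    · exact .ahead 0
    · rw [(o5 d).1, (o5 d).2]
      exact .input 0 _ (by simp)
  | wait p =>
    rw [trans_two] at hs'
    split_ifs at hs' <;> subst hs'
    · exact .equal p 0
    · exact .ahead p
    · exact .wait (p + 1)
  | equal p j =>
    rw [trans_three, if_pos rfl] at hs'
    subst hs'
    exact .equal p (j + 1)
  | ahead p =>
    rw [trans_four] at hs'
    subst hs'
    rw [(o5 _).1, (o5 _).2]
    exact .compare p 0 _ rfl
  | compare p j s hs =>
    subst hs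
    rw [trans_compare] at hs'
    have : T.out (T.mem (r p) j) (r (p + 1 - 1) (j + 2 - 1)) = some (r (p + 2 - 1) (j + 1 - 1)) :=
      hr p j
    rw [if_pos this] at hs'
    subst hs'
    rw [(o5 _).1, (o5 _).2]
    exact .compare p (j + 1) _ rfl
  | input j s hs =>
    subst hs
    rw [trans_input, getD_min, Nat.sub_self, Nat.add_sub_cancel, if_pos (h0 j).symm] at hs'
    subst hs'
    rw [add_assoc, (o5 _).1, (o5 _).2]
    exact .input (j + 1) _ (by omega)

theorem reachable_play {r : ℕ → ℕ → Fin m} (h0 : ∀ j, r 0 j = w.getD j pad)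
    (hr : ∀ p, T.Step (r p) (r (p + 1))) {s : Fin (5 + d + (w.length + 1))} (hs : (s : ℕ) = 1) {ρ}
    (hρ : ρ ∈ (model T w pad n k hn).outcomes s (writeRows T w pad r)) (t : ℕ) :
    Reachable T w r (ρ t) (waits 0 (historyOf ρ t)) (writes 0 (historyOf ρ t))
      (waits 1 (historyOf ρ t)) (writes 1 (historyOf ρ t)) := by
  induction t with
  | zero =>
    obtain ⟨ξ', h, -⟩ := id hρ
    have h : (ρ 0 : ℕ) = 1 := by rw [h, hs]
    have h' : waits 0 (historyOf ρ 0) = 1 ∧ writes 0 (historyOf ρ 0) = 0 ∧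
        waits 1 (historyOf ρ 0) = 1 ∧ writes 1 (historyOf ρ 0) = 0 := by
      simp [waits_historyOf, writes_historyOf, obs, h]
    rw [h, h'.1, h'.2.1, h'.2.2.1, h'.2.2.2]
    exact .start
  | succ t ih =>
    obtain ⟨c, hc⟩ := play_step T w pad _ hρ t
    rw [waits_succ, waits_succ, writes_succ, writes_succ]
    exact ih.step T w pad h0 hr c _ hc

theorem satisfies_of_runs (ok : Fin k) (h : T.Runs fun j => w.getD j pad)
    (s : Fin (5 + d + (w.length + 1))) (hs : (s : ℕ) = 1) :
    (model T w pad n k hn).SatState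
      (.coalition (players n) (PathFormula.globally (.state (.atom ok)))) s := by
  obtain ⟨r, h0, hr⟩ := h
  rw [ACGS.satState_globally_iff]
  exact ⟨writeRows T w pad r, fun ρ hρ t =>
    (reachable_play T w pad (congrFun h0) hr hs hρ t).ne_zero⟩

end Strategy

-- From a winning strategy to an infinite run.

/-- A history with `p + 1` signals to wait, followed by signals to write. -/
def pattern (d l p t : ℕ) : Fin (5 + d + (l + 1)) :=
  if t ≤ p then ⟨2, by omega⟩ else ⟨3, by omega⟩

section Forcing

variable {n k : ℕ} {hn : 3 ≤ n}

/-- The opponent chooses `0` before time `p` and `c` from then on. -/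
def opponent (p : ℕ) (c : Fin m) (h0 : 0 < m) :
    (model T w pad n k hn).CollectiveStrategy (players n)ᶜ where
  strat _ _ h := if h.1 < p then ⟨0, h0⟩ else c
  isStrategy i hi := by
    have : (model T w pad n k hn).type i = .IR := if_neg hi
    rw [this]
    exact fun _ => trivial

/-- A winning strategy yields a play against every such opponent. -/
theorem exists_play {ok : Fin k} (ξ : (model T w pad n k hn).CollectiveStrategy (players n))
    (s : Fin (5 + d + (w.length + 1))) (hs : (s : ℕ) = 1)
    (hξ : ∀ ρ ∈ (model T w pad n k hn).outcomes s ξ, ∀ t, ok ∈ (model T w pad n k hn).label (ρ t))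
    (p c : ℕ) (hc : c < m) :
    ∃ ρ : ℕ → Fin (5 + d + (w.length + 1)), (ρ 0 : ℕ) = 1 ∧ (∀ t, (ρ t : ℕ) ≠ 0) ∧
      ∀ t, (ρ (t + 1) : ℕ) = trans T w pad (ρ t)
        (ξ.strat ⟨0, by omega⟩ (zero_mem_players hn) (historyOf ρ t))
        (ξ.strat ⟨1, by omega⟩ (one_mem_players hn) (historyOf ρ t)) (if t < p then 0 else c) := by
  obtain ⟨ρ, hρ⟩ := ACGS.exists_isPlay _ s ξ (opponent T w pad p ⟨c, hc⟩ (by omega))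
  refine ⟨ρ, by rw [hρ.1, hs], hξ ρ ⟨_, hρ⟩, fun t => ?_⟩
  obtain ⟨a, ha, ha', h⟩ := hρ.2 t
  rw [h, ← ha, ← ha]
  have := ha' ⟨2, by omega⟩ (by simp [players])
  change trans T w pad _ _ _ _ = _
  rw [this]
  simp only [opponent, historyOf]
  split_ifs <;> rfl

/-- The play waits up to time `p`. -/
theorem play_wait {ρ : ℕ → ℕ} (h0 : ρ 0 = 1) {a b : ℕ → Fin m} {p c : ℕ}
    (hstep : ∀ t, ρ (t + 1) = trans T w pad (ρ t) (a t) (b t) (if t < p then 0 else c))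
    (t : ℕ) (ht : t ≤ p) : ρ t = 1 ∨ ρ t = 2 := by
  induction t with
  | zero => exact .inl h0
  | succ t ih =>
    rw [hstep, if_pos (by omega)]
    rcases ih (by omega) with h | h <;> rw [h]
    · exact .inr (by simp [trans_one])
    · exact .inr (by simp [trans_two])

/-- What player `i` writes at position `j` after `p + 1` signals to wait. -/
def written (ξ : (model T w pad n k hn).CollectiveStrategy (players n)) (i : Fin n)
    (hi : i ∈ players n) (p j : ℕ) : Fin m :=
  ξ.strat i hi (historyOf (pattern d w.length p) (p + 1 + j))

/-- Uniformity of `iR`-strategies: both players see `2` as wait and `3` as write, so the history is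
indistinguishable from `pattern`, which need not be part of a play. -/
theorem strat_eq_written (ξ : (model T w pad n k hn).CollectiveStrategy (players n)) (i : Fin n)
    (hi : i ∈ players n) (ρ : ℕ → Fin (5 + d + (w.length + 1))) (p j : ℕ)
    (h : ∀ t, t ≤ p → obs i (ρ t) = 0) (h' : ∀ t, p < t → obs i (ρ t) = 1) :
    ξ.strat i hi (historyOf ρ (p + 1 + j)) = written T w pad ξ i hi p j := by
  have hs := ξ.isStrategy i hi
  have : (model T w pad n k hn).type i = .iR := if_pos hi
  rw [this] at hs
  refine hs.2 _ _ (.mk _ _ _ fun l => ?_)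
  change obs i _ = obs i _
  rcases hi with hi | hi <;> by_cases hl : (l : ℕ) ≤ p
  · rw [h _ hl, hi]; simp [obs, pattern, hl]
  · rw [h' _ (by omega), hi]; simp [obs, pattern, hl]
  · rw [h _ hl, hi]; simp [obs, pattern, hl]
  · rw [h' _ (by omega), hi]; simp [obs, pattern, hl]

theorem trans_wait {s c : ℕ} (hs : s = 1 ∨ s = 2) (a b : Fin m) :
    (c = 1 → trans T w pad s a b c = 3) ∧ (c = 2 → trans T w pad s a b c = 4) := by
  rcases hs with rfl | rfl <;> constructor <;> rintro rfl <;> simp [trans_one, trans_two]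

theorem obs_wait {s : ℕ} (hs : s = 1 ∨ s = 2) (i : ℕ) (hi : i < 2) : obs i s = 0 := by
  rcases hs with rfl | rfl <;> simp [obs] <;> omega

theorem runs_of_satisfies (hm : 4 ≤ m) (ok : Fin k) (s : Fin (5 + d + (w.length + 1)))
    (hs : (s : ℕ) = 1)
    (h : (model T w pad n k hn).SatState
      (.coalition (players n) (PathFormula.globally (.state (.atom ok)))) s) :
    T.Runs fun j => w.getD j pad := by
  rw [ACGS.satState_globally_iff] at h
  obtain ⟨ξ, hξ⟩ := h
  let u := written T w pad ξ ⟨0, by omega⟩ (zero_mem_players hn)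
  let v := written T w pad ξ ⟨1, by omega⟩ (one_mem_players hn)
  -- Choice `1` at time `p` starts the equality test.
  have heq : ∀ p j, u p j = v p j := by
    intro p j
    obtain ⟨ρ, h0, hne, hstep⟩ := exists_play T w pad ξ s hs hξ p 1 (by omega)
    have hwait := play_wait T w pad (ρ := fun t => (ρ t : ℕ)) h0 hstep
    have hgo : ∀ j, (ρ (p + 1 + j) : ℕ) = 3 := by
      intro j
      induction j with
      | zero => rw [add_zero, hstep]; exact (trans_wait T w pad (hwait p le_rfl) _ _).1 (by simp)
      | succ j ih =>
        have h1 := hstep (p + 1 + j)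
        have h2 := hne (p + 1 + j + 1)
        rw [ih, trans_three] at h1
        split_ifs at h1 with h3
        · exact h1
        · exact absurd h1 h2
    have hobs : ∀ i t, i < 2 → p < t → obs i (ρ t) = 1 := by
      intro i t hi ht
      obtain ⟨j, rfl⟩ := Nat.exists_eq_add_of_le (Nat.succ_le_of_lt ht)
      rw [hgo]
      simp [obs]; omega
    have h1 := hstep (p + 1 + j)
    have h2 := hne (p + 1 + j + 1)
    rw [hgo, trans_three] at h1
    split_ifs at h1 with h3
    · have hA := strat_eq_written T w pad ξ ⟨0, by omega⟩ (zero_mem_players hn) ρ p j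
        (fun t ht => obs_wait (hwait t ht) _ (by simp)) (fun t ht => hobs _ t (by simp) ht)
      have hB := strat_eq_written T w pad ξ ⟨1, by omega⟩ (one_mem_players hn) ρ p j
        (fun t ht => obs_wait (hwait t ht) _ (by simp)) (fun t ht => hobs _ t (by simp) ht)
      exact hA.symm.trans (h3.trans hB)
    · exact absurd h1 h2
  -- Choice `3` starts the input test; it is offered only in the initial state, so it concerns row
  -- `0` alone.
  have hinput : ∀ j, u 0 j = w.getD j pad := by
    intro j
    obtain ⟨ρ, h0, hne, hstep⟩ := exists_play T w pad ξ s hs hξ 0 3 (by omega)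
    have hgo : ∀ j, (ρ (0 + 1 + j) : ℕ) = 5 + d + min j w.length := by
      intro j
      induction j with
      | zero => rw [add_zero, hstep, h0, trans_one]; simp
      | succ j ih =>
        have h1 := hstep (0 + 1 + j)
        have h2 := hne (0 + 1 + j + 1)
        rw [ih, trans_input] at h1
        split_ifs at h1 with h3
        · exact h1.trans (by omega)
        · exact absurd h1 h2
    have h1 := hstep (0 + 1 + j)
    have h2 := hne (0 + 1 + j + 1)
    rw [hgo, trans_input, getD_min] at h1
    have hA := strat_eq_written T w pad ξ ⟨0, by omega⟩ (zero_mem_players hn) ρ 0 j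
      (fun t ht => by obtain rfl : t = 0 := by omega
                      exact obs_wait (.inl h0) _ (by simp))
      (fun t ht => by obtain ⟨j, rfl⟩ := Nat.exists_eq_add_of_le (Nat.succ_le_of_lt ht)
                      exact obs_write _ _ (by simp) (by rw [hgo]; omega))
    rw [hA] at h1
    by_contra hcon
    rw [if_neg (fun h => hcon h.symm)] at h1
    exact h2 h1
  have hsucc : ∀ p, T.Step (u p) (v (p + 1)) := by
    intro p
    obtain ⟨ρ, h0, hne, hstep⟩ := exists_play T w pad ξ s hs hξ p 2 (by omega)
    have hwait := play_wait T w pad (ρ := fun t => (ρ t : ℕ)) h0 hstep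
    have hahead : (ρ (p + 1) : ℕ) = 4 := by
      rw [hstep]; exact (trans_wait T w pad (hwait p le_rfl) _ _).2 (by simp)
    have hcomp : ∀ j, ∃ e : Fin d, (ρ (p + 2 + j) : ℕ) = 5 + e := by
      intro j
      induction j with
      | zero => exact ⟨_, by rw [add_zero, hstep, hahead, trans_four]⟩
      | succ j ih =>
        obtain ⟨e, he⟩ := ih
        have h1 := hstep (p + 2 + j)
        have h2 := hne (p + 2 + j + 1)
        rw [he, trans_compare] at h1
        split_ifs at h1 with h3
        · exact ⟨_, h1⟩
        · exact absurd h1 h2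
    have hfar : ∀ t, p + 1 < t → 5 ≤ (ρ t : ℕ) := by
      intro t ht
      obtain ⟨j, rfl⟩ := Nat.exists_eq_add_of_le (Nat.succ_le_of_lt ht)
      obtain ⟨e, he⟩ := hcomp j
      rw [show (p + 1).succ + j = p + 2 + j from rfl, he]
      omega
    have hA : ∀ j, ξ.strat ⟨0, by omega⟩ (zero_mem_players hn) (historyOf ρ (p + 1 + j)) = u p j := by
      refine fun j => strat_eq_written T w pad ξ _ _ ρ p j
        (fun t ht => obs_wait (hwait t ht) _ (by simp)) fun t ht => ?_
      rcases (Nat.succ_le_of_lt ht).eq_or_lt with rfl | ht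
      · rw [Nat.succ_eq_add_one, hahead]; rfl
      · exact obs_write _ _ (by simp) (hfar t ht)
    have hB : ∀ j, ξ.strat ⟨1, by omega⟩ (one_mem_players hn) (historyOf ρ (p + 2 + j)) = v (p + 1) j := by
      refine fun j => strat_eq_written T w pad ξ _ _ ρ (p + 1) j (fun t ht => ?_)
        fun t ht => obs_write _ _ (by simp) (hfar t ht)
      rcases ht.eq_or_lt with rfl | ht
      · rw [hahead]; rfl
      · exact obs_wait (hwait t (by omega)) _ (by simp)
    have hkey : ∀ j (e : Fin d), (ρ (p + 2 + j) : ℕ) = 5 + e →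
        T.out e (u p (j + 1)) = some (v (p + 1) j) ∧
          (ρ (p + 2 + (j + 1)) : ℕ) = 5 + T.next e (u p (j + 1)) := by
      intro j e he
      have h1 := hstep (p + 2 + j)
      -- The same time is position `j` for agent `1` and `j + 1` for agent `0`: this lead is the
      -- lookahead of the transducer.
      rw [he, trans_compare, hB, show p + 2 + j = p + 1 + (j + 1) by omega, hA] at h1
      rw [show p + 2 + (j + 1) = p + 1 + (j + 1) + 1 by omega]
      by_cases h3 : T.out e (u p (j + 1)) = some (v (p + 1) j)
      · rw [if_pos h3] at h1
        exact ⟨h3, h1⟩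
      · rw [if_neg h3] at h1
        exact absurd h1 (hne _)
    have hmem : ∀ j, (ρ (p + 2 + j) : ℕ) = 5 + T.mem (u p) j := by
      intro j
      induction j with
      | zero => rw [add_zero, hstep, hahead, trans_four, hA 0]; rfl
      | succ j ih => exact (hkey j _ ih).2
    exact fun j => (hkey j _ (hmem j)).1
  refine ⟨u, funext hinput, fun p => ?_⟩
  rw [show u (p + 1) = v (p + 1) from funext (heq _)]
  exact hsucc p

end Forcing

end RowGame

-- Correctness and computability of the reduction.

namespace RowGame

variable {m d : ℕ} (T : RowTransducer (Fin m) (Fin d)) (pad : Fin m)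

theorem instanceOf_satisfies_iff (w : List (Fin m)) (n k : ℕ) (hn : 3 ≤ n) (hm : 4 ≤ m)
    (ok : Fin k) :
    (instanceOf T w pad n k hn).Satisfies
      (.coalition (players n) (PathFormula.globally (.state (.atom ok)))) ↔
      T.Runs fun j => w.getD j pad :=
  ⟨fun h => runs_of_satisfies (hn := hn) T w pad hm ok ⟨1, by omega⟩ rfl (h _ rfl),
    fun h s hs => satisfies_of_runs (hn := hn) T w pad ok h s hs⟩

theorem primrec_finTable {N : ℕ} (f : Fin N → ℕ) :
    Primrec fun s : ℕ => if h : s < N then f ⟨s, h⟩ else 0 := by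
  refine ((Primrec.list_getD 0).comp (.const (List.ofFn f)) .id).of_eq fun s => ?_
  by_cases h : s < N <;> simp [List.getD_eq_getElem?_getD, h]

/-- For fixed letters the transducer contributes only a finite table; what remains is arithmetic on
`s` and a lookup in `w`. -/
theorem primrec_trans (a b : Fin m) (c : ℕ) :
    Primrec₂ fun (w : List (Fin m)) s => trans T w pad s a b c := by
  have hs : ∀ x : ℕ, PrimrecPred fun p : List (Fin m) × ℕ => p.2 = x :=
    fun x => Primrec.eq.comp .snd (.const x)
  let f : Fin d → ℕ := fun e => if T.out e a = some b then 5 + T.next e a else 0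
  have hlt : PrimrecPred fun p : List (Fin m) × ℕ => p.2 - 5 < d :=
    Primrec.nat_lt.comp (Primrec.nat_sub.comp .snd (.const 5)) (.const d)
  have hf : Primrec fun p : List (Fin m) × ℕ => if h : p.2 - 5 < d then f ⟨p.2 - 5, h⟩ else 0 :=
    (primrec_finTable f).comp (Primrec.nat_sub.comp .snd (.const 5))
  have hw : PrimrecPred fun p : List (Fin m) × ℕ => p.1.getD (p.2 - (5 + d)) pad = a :=
    Primrec.eq.comp ((Primrec.list_getD pad).comp .fst (Primrec.nat_sub.comp .snd (.const _)))
      (.const a)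
  have hmin : Primrec fun p : List (Fin m) × ℕ => min (p.2 + 1) (5 + d + p.1.length) :=
    Primrec.nat_min.comp (Primrec.succ.comp .snd)
      (Primrec.nat_add.comp (.const _) (Primrec.list_length.comp .fst))
  refine (Primrec.ite (hs 0) (.const 0) <|
    .ite (hs 1) (.const (if c = 0 then 2 else if c = 1 then 3 else if c = 2 then 4 else 5 + d)) <|
    .ite (hs 2) (.const (if c = 1 then 3 else if c = 2 then 4 else 2)) <|
    .ite (hs 3) (.const (if a = b then 3 else 0)) <| .ite (hs 4) (.const (5 + (T.start a : ℕ))) <|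
    .ite hlt hf <| .ite hw hmin (.const 0)).of_eq fun p => ?_
  simp only [trans]
  by_cases h : p.2 - 5 < d
  · simp only [h, dif_pos, if_true, f]
  · simp only [h, dif_neg, if_false, not_false_iff]

theorem ofFn_eq_map_range {α : Type*} (N : ℕ) (f : ℕ → α) :
    (List.ofFn fun i : Fin N => f i) = (List.range N).map f := by
  apply List.ext_getElem <;> simp

/-- The description of a game is computable from the word `w`. -/
theorem primrec_code (n k : ℕ) (hn : 3 ≤ n) :
    Primrec fun w => (instanceOf T w pad n k hn).code := by
  classical
  have hN : Primrec fun w : List (Fin m) => 5 + d + (w.length + 1) :=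
    Primrec.nat_add.comp (.const _) (Primrec.succ.comp Primrec.list_length)
  have table {α : Type} [Primcodable α] {f : List (Fin m) → ℕ → α} (hf : Primrec₂ f) :
      Primrec fun w => List.ofFn fun s : Fin (5 + d + (w.length + 1)) => f w s := by
    simp only [ofFn_eq_map_range]
    exact Primrec.list_map (Primrec.list_range.comp hN) hf
  have hobs (i : ℕ) : Primrec (obs i) := by
    have h (x : ℕ) : PrimrecPred fun s : ℕ => s = x := Primrec.eq.comp .id (.const x)
    unfold obs
    split_ifs
    · exact Primrec.ite ((h 1).or (h 2)) (.const _) (.const _)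
    · exact Primrec.ite ((h 1).or ((h 2).or (h 4))) (.const _) (.const _)
    · exact .id
  refine Primrec.pair hN <| .pair (.const (List.ofFn fun _ : Fin n => m)) <| .pair ?_ <|
    .pair ?_ <| .pair ?_ <| .pair ?_ <| .pair ?_ <| .const (List.ofFn fun i : Fin n =>
      (if (i : ℕ) = 0 ∨ (i : ℕ) = 1 then StrategyType.iR else .IR).code)
  · refine (table (f := fun _ s => decide (s = 1))
      (Primrec.eq.comp Primrec.snd (.const 1)).decide).of_eq fun w => ?_
    exact congrArg List.ofFn (funext fun s => decide_eq_decide.2 Iff.rfl)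
  · refine Primrec.list_ofFn fun i => ?_
    refine (table (f := fun w s => (List.range (5 + d + (w.length + 1))).map fun t =>
      decide (obs i s = obs i t)) ?_).of_eq fun w => ?_
    · refine Primrec.list_map (Primrec.list_range.comp (hN.comp .fst)) ?_
      exact (Primrec.eq.comp ((hobs i).comp (Primrec.snd.comp .fst))
        ((hobs i).comp Primrec.snd)).decide
    · exact congrArg List.ofFn (funext fun s => (ofFn_eq_map_range _ _).symm.trans <|
        congrArg List.ofFn (funext fun t => decide_eq_decide.2 Iff.rfl))
  · refine Primrec.list_ofFn fun i => ?_
    refine (table (f := fun _ _ => List.ofFn fun _ : Fin m => true) (.const _)).of_eq fun w => ?_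
    exact congrArg List.ofFn (funext fun s => congrArg List.ofFn
      (funext fun t => by rw [eq_comm, decide_eq_true_iff]; trivial))
  · refine table (f := fun w s => List.ofFn fun a : Fin (∏ _i : Fin n, m) =>
      trans T w pad s (finPiFinEquiv.symm a ⟨0, by omega⟩) (finPiFinEquiv.symm a ⟨1, by omega⟩)
        (finPiFinEquiv.symm a ⟨2, by omega⟩ : Fin m)) ?_
    exact Primrec.list_ofFn fun a => primrec_trans T pad _ _ _
  · refine (table (f := fun _ s => List.ofFn fun _ : Fin k => decide (s ≠ 0)) ?_).of_eq fun w => ?_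
    · refine Primrec.list_ofFn fun _ => ?_
      exact (Primrec.eq.comp Primrec.snd (.const 0)).not.decide
    · exact congrArg List.ofFn (funext fun s => congrArg List.ofFn
        (funext fun t => decide_eq_decide.2 Iff.rfl))

end RowGame

-- Undecidability, from the halting problem on input `0`.

theorem mainTheorem2 (k : ℕ) (ok : Fin k) (n : ℕ) (hn : 3 ≤ n) :
    ¬ ModelCheckingDecidable
      {M : FiniteACGS n k | ∀ i : Fin n,
        ((i : ℕ) = 0 ∨ (i : ℕ) = 1 → M.model.type i = .iR) ∧
        (¬ ((i : ℕ) = 0 ∨ (i : ℕ) = 1) → M.model.type i = .IR)}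
      (.coalition {i : Fin n | (i : ℕ) = 0 ∨ (i : ℕ) = 1}
        (PathFormula.globally (.state (.atom ok)))) := by
  rintro ⟨f, hf, hdec⟩
  obtain ⟨m, d, T, w, pad, hm, hw, hT⟩ := RowTransducer.exists_universal
  refine ComputablePred.halting_problem 0 ?_
  refine ComputablePred.computable_iff.2
    ⟨fun c => !f (RowGame.instanceOf T (w c) pad n k hn).code, ?_, funext fun c => ?_⟩
  · exact Primrec.not.to_comp.comp
      (hf.comp ((RowGame.primrec_code T pad n k hn).to_comp.comp hw))
  · have h := (hdec (RowGame.instanceOf T (w c) pad n k hn)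
      (fun i => ⟨fun hi => if_pos hi, fun hi => if_neg hi⟩)).trans
      (RowGame.instanceOf_satisfies_iff T pad (w c) n k hn hm ok)
    rw [hT] at h
    refine propext ?_
    rw [Bool.not_eq_true', ← Bool.not_eq_true, h, not_not]
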